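/- **Setting.** Let $d,N\in\mathbb N$ (with $N=0$ allowed), let $R_x\ge 0$, and let $\mathcal F=\mathcal F(\mathbb R^d)$ be a class of closed, convex and proper functions $f:\mathbb R^d\to\mathbb R\cup\{+\infty\}$ (classes of real-valued convex functions are included). Write $f_*=\inf f$. * *Input.* $(f,x_0)$ is an $(\mathcal F,R_x)$-input if $f\in\mathcal F$, $x_0\in\mathbb R^d$, and $\|x_0-x_*\|\le R_x$ for some minimizer $x_*$ of $f$. * *Greedy first-order method.* An execution of $N$ iterations on $(f,x_0)$ consists of points $x_0,\dots,x_N$ and subgradients $f'(x_i)\in\partial f(x_i)$, $0\le i\le N$, such that for $i=1,\dots,N$ $$x_i\in\operatorname{argmin}\{f(x):x\in x_0+\operatorname{span}\{f'(x_0),\dots,f'(x_{i-1})\}\},\qquad \langle f'(x_i),f'(x_j)\rangle=0\ \ (0\le j<i).$$ Its output is $x_N$. $\mathrm{GFOM}_N(f,x_0)$ denotes any output of any such execution (there may be none, or several). * *Interpolability.* A finite family of triplets $\{(x_i,g_i,f_i)\}_{i\in I}$ in $\mathbb R^d\times\mathbb R^d\times\mathbb R$ is $\mathcal F$-interpolable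 if some $f\in\mathcal F$ has $g_i\in\partial f(x_i)$ and $f(x_i)=f_i$ for all $i\in I$. The class $\mathcal F$ is contraction-preserving if, whenever $\{(x_i,g_i,f_i)\}_{i\in I}$ ($I$ finite) is $\mathcal F$-interpolable and $\hat x_i\in\mathbb R^d$ satisfy $\|\hat x_i-\hat x_j\|\le\|x_i-x_j\|$ and $\langle g_j,\hat x_i-\hat x_j\rangle=\langle g_j,x_i-x_j\rangle$ for all $i,j\in I$, the family $\{(\hat x_i,g_i,f_i)\}_{i\in I}$ is $\mathcal F$-interpolable. * *Gram representation.* Let $I^*_N=\{*,0,\dots,N\}$. For $\{(x_i,g_i,f_i)\}_{i\in I^*_N}$ with $g_*=0$ put $$P=[\,g_0\ \cdots\ g_N\mid x_1-x_0\ \cdots\ x_N-x_0\mid x_*-x_0\,],\quad G=P^\top P\in\mathbb R^{(2N+2)\times(2N+2)},\quad F=(f_0,\dots,f_N,f_*)^\top\in\mathbb R^{N+2}.$$ In $\mathbb R^{2N+2}$ let $\mathbf x_0=0$, $\mathbf x_i=e_{N+1+i}$ ($1\le i\le N$), $\mathbf x_*=e_{2N+2}$, $\mathbf g_i=e_{i+1}$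 ($0\le i\le N$); in $\mathbb R^{N+2}$ let $\mathbf f_i=e_{i+1}$ ($0\le i\le N$) and $\mathbf f_*=e_{N+2}$. Write $x\odot y=\tfrac12(xy^\top+yx^\top)$, and $M\succeq0$ for "$v^\top Mv\ge0$ for all $v$". * *Encoding of the interpolation conditions.* Assume that there are a finite index set $K_N$, matrices $A_k\in\mathbb R^{(2N+2)\times(2N+2)}$, vectors $a_k\in\mathbb R^{N+2}$ and scalars $b_k\in\mathbb R$ ($k\in K_N$) such that every family $\{(x_i,g_i,f_i)\}_{i\in I^*_N}$ with $g_*=0$ is $\mathcal F$-interpolable if and only if $\operatorname{Tr}(A_kG)+a_k^\top F+b_k\le0$ for all $k\in K_N$. Let $\mathrm{val}\in[-\infty,+\infty]$ be the optimal value ($+\infty$ if infeasible) of $$\begin{aligned}\inf_{\{\alpha_k\},\{\beta_{i,j}\},\{\gamma_{i,j}\},\tau_x}\ &\tau_xR_x^2-\sum_{k\in K_N}\alpha_kb_k\\ \text{s.t. }&\alpha_k\ge0,\ \tau_x\ge0,\\ &\sum_{k\in K_N}\alpha_kA_k+\sum_{i=1}^N\mathbf g_i\odot\Big[\sum_{j=0}^{i-1}\beta_{i,j}\mathbf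 g_j+\sum_{j=1}^i\gamma_{i,j}(\mathbf x_j-\mathbf x_0)\Big]+\tau_x(\mathbf x_0-\mathbf x_*)\odot(\mathbf x_0-\mathbf x_*)\succeq0,\\ &\mathbf f_N-\mathbf f_*-\sum_{k\in K_N}\alpha_ka_k=0.\end{aligned}$$ **Theorem.** For every $(\mathcal F,R_x)$-input $(f,x_0)$ and every output of $\mathrm{GFOM}_N$ on it, $$f(\mathrm{GFOM}_N(f,x_0))-f_*\le\mathrm{val}.$$ Furthermore, if $\mathcal F$ is contraction-preserving, $d\ge2N+2$, and there is an $(\mathcal F,R_x)$-input $(\hat f,\hat x_0)$ for which some output $\mathrm{GFOM}_{2N+1}(\hat f,\hat x_0)$ exists and is not a minimizer of $\hat f$, then the bound is tight: $\mathrm{val}$ is the least upper bound in $[-\infty,+\infty]$ of the values $f(\mathrm{GFOM}_N(f,x_0))-f_*$ over all $(\mathcal F,R_x)$-inputs $(f,x_0)$ and all outputs. -/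

import Mathlib

noncomputable section

namespace PEP

/-- The Euclidean space `ℝ^d`. -/
abbrev Vec (d : ℕ) : Type := EuclideanSpace ℝ (Fin d)

/-- Closed (lower semicontinuous), convex (convex epigraph) and proper functions on `ℝ^d`, with
values in `ℝ ∪ {+∞}`. Real-valued functions are included through the coercion. -/
structure IsCCP {d : ℕ} (f : Vec d → EReal) : Prop where
  closed : LowerSemicontinuous f
  convex : Convex ℝ {p : Vec d × ℝ | f p.1 ≤ (p.2 : EReal)}
  ne_bot : ∀ x, f x ≠ ⊥
  exists_ne_top : ∃ x, f x ≠ ⊤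

/-- `g ∈ ∂f(x)`. For a proper `f` this forces `f x` to be finite. -/
def IsSubgradient {d : ℕ} (f : Vec d → EReal) (x g : Vec d) : Prop :=
  ∀ y, f x + ((inner ℝ g (y - x) : ℝ) : EReal) ≤ f y

/-- `(f, x₀)` is an `(𝓕, R)`-input: `f ∈ 𝓕` and `x₀` is within distance `R` of a minimizer. -/
def IsInput {d : ℕ} (𝓕 : Set (Vec d → EReal)) (R : ℝ) (f : Vec d → EReal) (x₀ : Vec d) : Prop :=
  f ∈ 𝓕 ∧ ∃ xs : Vec d, (∀ y, f xs ≤ f y) ∧ ‖x₀ - xs‖ ≤ R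

/-- The triplets `(x i, g i, v i)`, `i ∈ ι`, are `𝓕`-interpolable. -/
def Interpolable {d : ℕ} (𝓕 : Set (Vec d → EReal)) {ι : Type} (x g : ι → Vec d) (v : ι → ℝ) :
    Prop :=
  ∃ f ∈ 𝓕, ∀ i, IsSubgradient f (x i) (g i) ∧ f (x i) = (v i : EReal)

/-- Contraction-preserving classes. -/
def ContractionPreserving {d : ℕ} (𝓕 : Set (Vec d → EReal)) : Prop :=
  ∀ (ι : Type) [Finite ι] (x g : ι → Vec d) (v : ι → ℝ) (x' : ι → Vec d),
    Interpolable 𝓕 x g v →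
    (∀ i j, ‖x' i - x' j‖ ≤ ‖x i - x j‖) →
    (∀ i j, inner ℝ (g j) (x' i - x' j) = inner ℝ (g j) (x i - x j)) →
    Interpolable 𝓕 x' g v

/-- `x 0, …, x N` and `g 0, …, g N` are the iterates and the chosen subgradients of an execution
of `N` iterations of the greedy first-order method on `(f, x₀)`. Entries beyond `N` are
irrelevant. -/
structure IsGFOMRun {d : ℕ} (f : Vec d → EReal) (x₀ : Vec d) (N : ℕ) (x g : ℕ → Vec d) :
    Prop where
  start : x 0 = x₀
  subgrad : ∀ i ≤ N, IsSubgradient f (x i) (g i)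
  mem : ∀ i, 1 ≤ i → i ≤ N → x i - x₀ ∈ Submodule.span ℝ (g '' Set.Iio i)
  isMin : ∀ i, 1 ≤ i → i ≤ N →
    ∀ y : Vec d, y - x₀ ∈ Submodule.span ℝ (g '' Set.Iio i) → f (x i) ≤ f y
  orth : ∀ i, 1 ≤ i → i ≤ N → ∀ j < i, inner ℝ (g i) (g j) = 0

/-- `y` is a possible output `GFOM_N(f, x₀)`. The method is nondeterministic (choice of the
minimizers and of the subgradients) and may have no output at all. -/
def IsGFOMOutput {d : ℕ} (f : Vec d → EReal) (x₀ : Vec d) (N : ℕ) (y : Vec d) : Prop :=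
  ∃ x g : ℕ → Vec d, IsGFOMRun f x₀ N x g ∧ x N = y

/-- The absolute inaccuracy `f(y) - f_*`. -/
def inaccuracy {d : ℕ} (f : Vec d → EReal) (y : Vec d) : EReal := f y - ⨅ z, f z

/-- The index set `I*_N = {*, 0, …, N}`; `none` stands for `*`. -/
abbrev StarIdx (N : ℕ) : Type := Option (Fin (N + 1))

/-- Indices of the `2N + 2` columns `g_0, …, g_N | x_1 - x_0, …, x_N - x_0 | x_* - x_0`. -/
abbrev GramIdx (N : ℕ) : Type := Fin (N + 1) ⊕ Fin N ⊕ Unit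

theorem card_gramIdx (N : ℕ) : Fintype.card (GramIdx N) = 2 * N + 2 := by
  simp only [Fintype.card_sum, Fintype.card_fin, Fintype.card_unit]
  omega

/-- The columns of the matrix `P`. -/
def cols {d N : ℕ} (x g : StarIdx N → Vec d) : GramIdx N → Vec d
  | .inl i => g (some i)
  | .inr (.inl i) => x (some i.succ) - x (some 0)
  | .inr (.inr _) => x none - x (some 0)

/-- The Gram matrix `G = Pᵀ P`. -/
def gramMatrix {d N : ℕ} (x g : StarIdx N → Vec d) : Matrix (GramIdx N) (GramIdx N) ℝ :=
  Matrix.gram ℝ (cols x g)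

/-- Coordinate vectors of the points: `P (xVec i) = x_i - x_0`. -/
def xVec {N : ℕ} : StarIdx N → GramIdx N → ℝ
  | none => Pi.single (.inr (.inr ())) 1
  | some i => Fin.cases 0 (fun j => Pi.single (.inr (.inl j)) 1) i

/-- Coordinate vectors of the subgradients: `P (gVec i) = g_i`, with `g_* = 0`. -/
def gVec {N : ℕ} : StarIdx N → GramIdx N → ℝ
  | none => 0
  | some i => Pi.single (.inl i) 1

/-- Coordinate vectors of the function values. -/
def fVec {N : ℕ} (i : StarIdx N) : StarIdx N → ℝ := Pi.single i 1

/-- The symmetric outer product `x ⊙ y = (x yᵀ + y xᵀ) / 2`. -/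
def symOuter {ι : Type} (x y : ι → ℝ) : Matrix ι ι ℝ :=
  (1 / 2 : ℝ) • (Matrix.vecMulVec x y + Matrix.vecMulVec y x)

/-- `M ⪰ 0`, i.e. `vᵀ M v ≥ 0` for all `v`. For symmetric `M` this is `Matrix.PosSemidef`, see
`psd_iff_posSemidef`; in general it says that the symmetric part of `M` is positive
semidefinite, so that the data of a semidefinite program need not be symmetrized. -/
def PSD {ι : Type} [Fintype ι] (M : Matrix ι ι ℝ) : Prop :=
  ∀ v : ι → ℝ, 0 ≤ v ⬝ᵥ (M.mulVec v)

theorem psd_iff_posSemidef {ι : Type} [Fintype ι] {M : Matrix ι ι ℝ} (hM : M.IsSymm) :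
    PSD M ↔ M.PosSemidef := by
  rw [Matrix.posSemidef_iff_dotProduct_mulVec]
  constructor
  · intro h
    refine ⟨?_, fun v => by simpa using h v⟩
    rw [Matrix.IsHermitian, Matrix.conjTranspose_eq_transpose_of_trivial]
    exact hM
  · intro h v
    simpa using h.2 v

/-- The matrices `A k`, vectors `a k` and scalars `b k` encode the interpolation conditions of `𝓕`
for sets of triplets indexed by `I*_N` with `g_* = 0`. -/
def EncodesInterpolation {d N : ℕ} (𝓕 : Set (Vec d → EReal)) {K : Type*}
    (A : K → Matrix (GramIdx N) (GramIdx N) ℝ) (a : K → StarIdx N → ℝ) (b : K → ℝ) : Prop :=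
  ∀ (x g : StarIdx N → Vec d) (v : StarIdx N → ℝ), g none = 0 →
    (Interpolable 𝓕 x g v ↔
      ∀ k, Matrix.trace (A k * gramMatrix x g) + a k ⬝ᵥ v + b k ≤ 0)

/-- The matrix required to be positive semidefinite in the dual program. -/
def dualMatrix {N : ℕ} {K : Type*} [Fintype K] (A : K → Matrix (GramIdx N) (GramIdx N) ℝ)
    (α : K → ℝ) (β γ : Fin (N + 1) → Fin (N + 1) → ℝ) (τ : ℝ) :
    Matrix (GramIdx N) (GramIdx N) ℝ :=
  ∑ k, α k • A k
    + ∑ i ∈ Finset.Ioi (0 : Fin (N + 1)), symOuter (gVec (some i))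
        (∑ j ∈ Finset.Iio i, β i j • gVec (some j)
          + ∑ j ∈ Finset.Ioc 0 i, γ i j • (xVec (some j) - xVec (some 0)))
    + τ • symOuter (xVec (some 0) - xVec none) (xVec (some 0) - xVec none)

/-- Feasibility for the dual program. -/
structure DualFeasible {N : ℕ} {K : Type*} [Fintype K]
    (A : K → Matrix (GramIdx N) (GramIdx N) ℝ) (a : K → StarIdx N → ℝ)
    (α : K → ℝ) (β γ : Fin (N + 1) → Fin (N + 1) → ℝ) (τ : ℝ) : Prop where
  α_nonneg : ∀ k, 0 ≤ α k
  τ_nonneg : 0 ≤ τ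
  psd : PSD (dualMatrix A α β γ τ)
  affine : fVec (some (Fin.last N)) - fVec none - ∑ k, α k • a k = 0

/-- The optimal value of the dual program, in `[-∞, +∞]` (`+∞` if it is infeasible). -/
def dualValue {N : ℕ} {K : Type*} [Fintype K] (R : ℝ)
    (A : K → Matrix (GramIdx N) (GramIdx N) ℝ) (a : K → StarIdx N → ℝ) (b : K → ℝ) : EReal :=
  sInf {w : EReal | ∃ (α : K → ℝ) (β γ : Fin (N + 1) → Fin (N + 1) → ℝ) (τ : ℝ),
    DualFeasible A a α β γ τ ∧ w = ((τ * R ^ 2 - ∑ k, α k * b k : ℝ) : EReal)}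

end PEP

end

/-! The worst case of the method is governed by a semidefinite program in the Gram matrix `G` and
the values `F`, of which `dualValue` is the Lagrangian dual. Its constraints are the interpolation
inequalities, `‖x₀ - x_*‖ ≤ R`, and the relations `g_i ⟂ g_j` for `j < i` and `g_i ⟂ x_j - x_0` for
`j ≤ i`; neither exact minimization nor span membership is imposed.

Upper bound: in an execution `x_j - x_0` lies in the span of earlier subgradients, which are
orthogonal to `g_i`, so its Gram matrix is feasible. Pairing it with a dual feasible matrix gives
the bound (`weak_duality`).

Tightness rests on three facts. (1) Every feasible `G ⪰ 0` is realized: `d ≥ 2N + 2` leaves room to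
factor `G` (`exists_gram_eq`), and projecting the points onto the span of the subgradients keeps all
products with subgradients and contracts distances. Contraction preservation gives a new
interpolating function, and orthogonality then restores both span membership and minimality
(`exists_run_of_interpolable`). (2) A positive definite feasible `G` exists: cut a longer execution
after step `m`, fill up with copies of the minimizer, and average over `m = 0, …, N`
(`exists_posDef_primalFeasible`). (3) With such a Slater point, any real upper bound on the primal
values over positive definite `G` is matched by dual multipliers (`strong_duality`). This follows
from separating an open convex cone from a polyhedron and from the affine Farkas lemma. -/

/-! ### Farkas lemmas and conic duality. -/

/-- **Farkas' lemma** for finitely many linear functionals on an arbitrary real vector space. -/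
theorem farkas_finset {E ι : Type*} [AddCommGroup E] [Module ℝ E] (s : Finset ι)
    (ℓ : ι → E →ₗ[ℝ] ℝ) (φ : E →ₗ[ℝ] ℝ) (h : ∀ y, (∀ i ∈ s, ℓ i y ≤ 0) → φ y ≤ 0) :
    ∃ c : ι → ℝ, (∀ i, 0 ≤ c i) ∧ ∀ y, φ y = ∑ i ∈ s, c i * ℓ i y := by
  classical
  induction s using Finset.induction_on generalizing ℓ φ with
  | empty =>
    refine ⟨0, fun _ => le_rfl, fun y => ?_⟩
    have h1 := h y (by simp)
    have h2 := h (-y) (by simp)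
    rw [map_neg] at h2
    simp only [Finset.sum_empty]
    linarith
  | insert k s hk ih =>
    by_cases hs : ∀ y, (∀ i ∈ s, ℓ i y ≤ 0) → φ y ≤ 0
    · obtain ⟨c, hc, hφ⟩ := ih ℓ φ hs
      refine ⟨Function.update c k 0, fun i => ?_, fun y => ?_⟩
      · by_cases hi : i = k
        · simp [hi]
        · simp [hi, hc i]
      · rw [Finset.sum_insert hk, hφ]
        simp only [Function.update_self, zero_mul, zero_add]
        refine Finset.sum_congr rfl fun i hi => ?_
        rw [Function.update_of_ne (ne_of_mem_of_not_mem hi hk)]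
    · push Not at hs
      obtain ⟨z, hz, hφz⟩ := hs
      have hkz : 0 < ℓ k z := by
        by_contra hcon
        refine absurd (h z fun i hi => ?_) (not_le.2 hφz)
        rcases Finset.mem_insert.1 hi with rfl | hi
        · exact not_lt.1 hcon
        · exact hz i hi
      -- Projection onto `ker (ℓ k)` along `z`. After composing with it the constraint `k` is void,
      -- so the induction hypothesis applies. The multiplier of `ℓ k` is fixed by evaluating at `z`,
      -- and it is nonnegative because `φ z > 0` while the other functionals are nonpositive at `z`.
      let π : E →ₗ[ℝ] E := LinearMap.id - (ℓ k).smulRight ((ℓ k z)⁻¹ • z)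
      have hπ : ∀ y, π y = y - (ℓ k y * (ℓ k z)⁻¹) • z := fun y => by simp [π, smul_smul]
      obtain ⟨c, hc, hφ⟩ := ih (fun i => ℓ i ∘ₗ π) (φ ∘ₗ π) fun y hy => by
        refine h (π y) fun i hi => ?_
        rcases Finset.mem_insert.1 hi with rfl | hi
        · rw [hπ, map_sub, map_smul, smul_eq_mul, mul_assoc, inv_mul_cancel₀ hkz.ne']
          simp
        · exact hy i hi
      have hsum : 0 ≤ φ z - ∑ i ∈ s, c i * ℓ i z := by
        have : ∑ i ∈ s, c i * ℓ i z ≤ 0 :=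
          Finset.sum_nonpos fun i hi => mul_nonpos_of_nonneg_of_nonpos (hc i) (hz i hi)
        linarith
      refine ⟨Function.update c k ((φ z - ∑ i ∈ s, c i * ℓ i z) * (ℓ k z)⁻¹), fun i => ?_,
        fun y => ?_⟩
      · by_cases hi : i = k
        · subst hi
          simp only [Function.update_self]
          exact mul_nonneg hsum (inv_nonneg.2 hkz.le)
        · simp [hi, hc i]
      · rw [Finset.sum_insert hk]
        have h1 := hφ y
        simp only [LinearMap.comp_apply, hπ, map_sub, map_smul, smul_eq_mul, mul_sub,
          Finset.sum_sub_distrib] at h1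
        have h2 : ∑ i ∈ s, Function.update c k
            ((φ z - ∑ i ∈ s, c i * ℓ i z) * (ℓ k z)⁻¹) i * ℓ i y = ∑ i ∈ s, c i * ℓ i y :=
          Finset.sum_congr rfl fun i hi => by
            rw [Function.update_of_ne (ne_of_mem_of_not_mem hi hk)]
        have h3 : ∑ i ∈ s, c i * (ℓ k y * (ℓ k z)⁻¹ * ℓ i z)
            = ℓ k y * (ℓ k z)⁻¹ * ∑ i ∈ s, c i * ℓ i z := by
          rw [Finset.mul_sum]
          exact Finset.sum_congr rfl fun i _ => by ring
        rw [h2, Function.update_self]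
        rw [h3] at h1
        linear_combination h1

/-- **Affine Farkas lemma**, with inequality and equality constraints. -/
theorem farkas_affine {E ι κ : Type*} [AddCommGroup E] [Module ℝ E] [Fintype ι] [Fintype κ]
    (ℓ : ι → E →ₗ[ℝ] ℝ) (c : ι → ℝ) (m : κ → E →ₗ[ℝ] ℝ) (φ : E →ₗ[ℝ] ℝ) (p : ℝ)
    (hne : ∃ y, (∀ i, ℓ i y ≤ c i) ∧ ∀ j, m j y = 0)
    (h : ∀ y, (∀ i, ℓ i y ≤ c i) → (∀ j, m j y = 0) → φ y ≤ p) :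
    ∃ (r : ι → ℝ) (s : κ → ℝ), (∀ i, 0 ≤ r i) ∧ ∑ i, r i * c i ≤ p ∧
      ∀ y, φ y = ∑ i, r i * ℓ i y + ∑ j, s j * m j y := by
  obtain ⟨y₀, hy₀, hm₀⟩ := hne
  -- Homogenization: an extra coordinate `t ≥ 0` multiplies the constants, and each equality is
  -- split into two inequalities.
  let L : Option (ι ⊕ κ ⊕ κ) → E × ℝ →ₗ[ℝ] ℝ := fun o => match o with
    | none => -LinearMap.snd ℝ E ℝ
    | some (.inl i) => ℓ i ∘ₗ LinearMap.fst ℝ E ℝ - c i • LinearMap.snd ℝ E ℝ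
    | some (.inr (.inl j)) => m j ∘ₗ LinearMap.fst ℝ E ℝ
    | some (.inr (.inr j)) => -(m j ∘ₗ LinearMap.fst ℝ E ℝ)
  obtain ⟨r, hr, hφ⟩ := farkas_finset Finset.univ L
    (φ ∘ₗ LinearMap.fst ℝ E ℝ - p • LinearMap.snd ℝ E ℝ) (by
      rintro ⟨y, t⟩ hy
      have ht : 0 ≤ t := by simpa [L] using hy none (Finset.mem_univ _)
      have hl : ∀ i, ℓ i y ≤ c i * t := fun i => by
        simpa [L] using hy (some (.inl i)) (Finset.mem_univ _)
      have hm : ∀ j, m j y = 0 := fun j => le_antisymm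
        (by simpa [L] using hy (some (.inr (.inl j))) (Finset.mem_univ _))
        (by simpa [L] using hy (some (.inr (.inr j))) (Finset.mem_univ _))
      -- `y + s • y₀` is admissible at level `t + s > 0`
      have key : ∀ s > 0, φ y + s * φ y₀ ≤ p * (t + s) := fun s hs => by
        have hts : 0 < t + s := by linarith
        have := h ((t + s)⁻¹ • (y + s • y₀)) (fun i => by
            rw [map_smul, smul_eq_mul, inv_mul_le_iff₀ hts, map_add, map_smul, smul_eq_mul]
            nlinarith [hl i, mul_le_mul_of_nonneg_left (hy₀ i) hs.le]) (fun j => by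
            simp [hm, hm₀])
        rw [map_smul, smul_eq_mul, inv_mul_le_iff₀ hts, map_add, map_smul, smul_eq_mul] at this
        linarith
      have : φ y ≤ p * t := by
        by_contra hcon
        push Not at hcon
        -- This is `key` in the limit `s → 0`. The perturbation by `y₀` covers level `t = 0`, where
        -- rescaling by `t` is impossible.
        obtain ⟨s, hs, hs'⟩ : ∃ s > 0, s * (p - φ y₀) < φ y - p * t := by
          refine ⟨(φ y - p * t) / (2 * (|p - φ y₀| + 1)), by
            have : 0 < φ y - p * t := by linarith
            positivity, ?_⟩
          have h1 : 0 < φ y - p * t := by linarith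
          have h2 := le_abs_self (p - φ y₀)
          have h3 : 0 < 2 * (|p - φ y₀| + 1) := by positivity
          rw [div_mul_eq_mul_div, div_lt_iff₀ h3]
          nlinarith [abs_nonneg (p - φ y₀)]
        have := key s hs
        linarith
      simpa using this)
  refine ⟨fun i => r (some (.inl i)),
    fun j => r (some (.inr (.inl j))) - r (some (.inr (.inr j))), fun i => hr _, ?_, fun y => ?_⟩
  · have := hφ (0, 1)
    simp [L, Fintype.sum_option] at this
    linarith [hr none]
  · have := hφ (y, 0)
    simp [L, Fintype.sum_option] at this
    rw [this]
    simp only [sub_mul, Finset.sum_sub_distrib]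
    ring

/-- **Conic strong duality** under a Slater condition: polyhedral constraints over an open convex
cone. -/
theorem exists_multipliers_of_le_on_open_cone {E ι κ : Type*} [AddCommGroup E] [Module ℝ E]
    [TopologicalSpace E] [IsTopologicalAddGroup E] [ContinuousSMul ℝ E] [Fintype ι] [Fintype κ]
    {U : Set E} (hUo : IsOpen U) (hUc : Convex ℝ U) (hU : ∀ t : ℝ, 0 < t → ∀ y ∈ U, t • y ∈ U)
    (ℓ : ι → E →ₗ[ℝ] ℝ) (c : ι → ℝ) (m : κ → E →ₗ[ℝ] ℝ) (φ : E →ₗ[ℝ] ℝ) (p : ℝ)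
    (hne : ∃ y ∈ U, (∀ i, ℓ i y ≤ c i) ∧ ∀ j, m j y = 0)
    (h : ∀ y ∈ U, (∀ i, ℓ i y ≤ c i) → (∀ j, m j y = 0) → φ y ≤ p) :
    ∃ (r : ι → ℝ) (s : κ → ℝ), (∀ i, 0 ≤ r i) ∧ ∑ i, r i * c i ≤ p ∧
      ∀ y ∈ U, φ y ≤ ∑ i, r i * ℓ i y + ∑ j, s j * m j y := by
  obtain ⟨y₀, hy₀U, hy₀, hm₀⟩ := hne
  -- If the polyhedral constraints alone already force `φ ≤ p`, Farkas suffices. Otherwise `D` is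
  -- nonempty, convex and disjoint from the open cone, and can be separated from it.
  let D : Set E := {y | (∀ i, ℓ i y ≤ c i) ∧ (∀ j, m j y = 0) ∧ p < φ y}
  by_cases hD : D = ∅
  · obtain ⟨r, s, hr, hp, hφ⟩ := farkas_affine ℓ c m φ p ⟨y₀, hy₀, hm₀⟩ fun y h1 h2 => by
      by_contra h3
      exact (hD ▸ (⟨h1, h2, not_le.1 h3⟩ : y ∈ D) : y ∈ (∅ : Set E))
    exact ⟨r, s, hr, hp, fun y _ => (hφ y).le⟩
  obtain ⟨y₁, hy₁, hm₁, hφ₁⟩ := Set.nonempty_iff_ne_empty.2 hD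
  have hDc : Convex ℝ D := by
    rintro y ⟨h1, h2, h3⟩ z ⟨h1', h2', h3'⟩ a b ha hb hab
    refine ⟨fun i => ?_, fun j => by simp [h2, h2'], ?_⟩
    · simp only [map_add, map_smul, smul_eq_mul]
      have e : c i = a * c i + b * c i := by rw [← add_mul, hab, one_mul]
      rw [e]
      exact add_le_add (mul_le_mul_of_nonneg_left (h1 i) ha)
        (mul_le_mul_of_nonneg_left (h1' i) hb)
    · simp only [map_add, map_smul, smul_eq_mul]
      rcases ha.eq_or_lt with rfl | ha
      · rw [zero_add] at hab
        simpa [hab] using h3'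
      · have e : p = a * p + b * p := by rw [← add_mul, hab, one_mul]
        rw [e]
        exact add_lt_add_of_lt_of_le (mul_lt_mul_of_pos_left h3 ha)
          (mul_le_mul_of_nonneg_left h3'.le hb)
  obtain ⟨g, u, hgU, hgD⟩ := geometric_hahn_banach_open hUc hUo hDc
    (Set.disjoint_left.2 fun y hy hyD => not_lt.2 (h y hy hyD.1 hyD.2.1) hyD.2.2)
  have hu : 0 ≤ u := by
    by_contra hu
    push Not at hu
    have hneg := hgU y₀ hy₀U
    have := hgU ((u / (2 * g y₀)) • y₀) (hU _ (div_pos_of_neg_of_neg hu (by linarith)) _ hy₀U)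
    have hne : g y₀ ≠ 0 := by linarith
    rw [map_smul, smul_eq_mul, div_mul_eq_mul_div, mul_comm 2, ← div_div,
      mul_div_cancel_right₀ _ hne] at this
    linarith
  have hgle : ∀ y ∈ U, g y ≤ 0 := fun y hy => by
    by_contra hpos
    push Not at hpos
    have := hgU (((u + 1) / g y) • y) (hU _ (by positivity) _ hy)
    rw [map_smul, smul_eq_mul, div_mul_cancel₀ _ hpos.ne'] at this
    linarith
  -- `g ≥ 0` on the closed polyhedron, where moreover `φ ≥ p`
  let ℓ' : Option ι → E →ₗ[ℝ] ℝ := fun o => o.elim (-φ) ℓ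
  let c' : Option ι → ℝ := fun o => o.elim (-p) c
  obtain ⟨r, s, hr, hp, hg⟩ := farkas_affine ℓ' c' m (-(g : E →ₗ[ℝ] ℝ)) (-u)
    ⟨y₁, fun o => by cases o <;> simp [ℓ', c', hy₁, hφ₁.le], hm₁⟩ (by
      intro y hl hm
      have hl1 : ∀ i, ℓ i y ≤ c i := fun i => hl (some i)
      have hp1 : p ≤ φ y := by simpa [ℓ', c'] using hl none
      -- Points of the segment from `y` to `y₁`, other than `y`, satisfy `φ > p` strictly and so lie
      -- in `D`; letting `t → 0` extends the separation bound to `y`.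
      have key : ∀ t : ℝ, 0 < t → t ≤ 1 → u ≤ g y + t * (g y₁ - g y) := fun t ht ht1 => by
        have := hgD (y + t • (y₁ - y)) ⟨fun i => ?_, fun j => by simp [hm, hm₁], ?_⟩
        · simpa using this
        · simp only [map_add, map_smul, map_sub, smul_eq_mul]
          nlinarith [hl1 i, hy₁ i]
        · simp only [map_add, map_smul, map_sub, smul_eq_mul]
          nlinarith
      have : u ≤ g y := by
        refine le_of_forall_pos_sub_le fun ε hε => ?_
        have hpos : 0 < |g y₁ - g y| + 1 := by positivity
        have h1 := key (min 1 (ε / (|g y₁ - g y| + 1))) (by positivity) (min_le_left _ _)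
        have h2 : min 1 (ε / (|g y₁ - g y| + 1)) * (g y₁ - g y) ≤ ε := by
          calc _ ≤ min 1 (ε / (|g y₁ - g y| + 1)) * (|g y₁ - g y| + 1) := by
                refine mul_le_mul_of_nonneg_left ?_ (by positivity)
                linarith [le_abs_self (g y₁ - g y)]
            _ ≤ ε / (|g y₁ - g y| + 1) * (|g y₁ - g y| + 1) :=
                mul_le_mul_of_nonneg_right (min_le_right _ _) hpos.le
            _ = ε := div_mul_cancel₀ _ hpos.ne'
        linarith
      simpa using this)
  simp only [Fintype.sum_option, ℓ', c', Option.elim, LinearMap.neg_apply,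
    ContinuousLinearMap.coe_coe] at hp hg
  -- The Slater point rules out a degenerate multiplier: without the `φ` term, Farkas would give `g
  -- y₀ ≥ u`, against strict separation on `U`.
  have hr0 : r none ≠ 0 := by
    intro hr0
    rw [hr0, zero_mul, zero_add] at hp
    have h1 := hg y₀
    rw [hr0, zero_mul, zero_add] at h1
    have h2 : ∑ i, r (some i) * ℓ i y₀ ≤ ∑ i, r (some i) * c i :=
      Finset.sum_le_sum fun i _ => mul_le_mul_of_nonneg_left (hy₀ i) (hr _)
    have h3 : ∑ j, s j * m j y₀ = 0 := by simp [hm₀]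
    have h4 := hgU y₀ hy₀U
    linarith
  have hpos : 0 < r none := (hr none).lt_of_ne' hr0
  refine ⟨fun i => (r none)⁻¹ * r (some i), fun j => (r none)⁻¹ * s j,
    fun i => mul_nonneg (inv_nonneg.2 hpos.le) (hr _), ?_, fun y hy => ?_⟩
  · simp only [mul_assoc, ← Finset.mul_sum]
    rw [inv_mul_le_iff₀ hpos]
    linarith
  · simp only [mul_assoc, ← Finset.mul_sum]
    rw [← mul_add, ← div_eq_inv_mul, le_div_iff₀ hpos]
    linarith [hg y, hgle y hy]

/-! ### Gram matrices, the primal program and weak duality. -/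

namespace PEP

open Matrix

theorem trace_symOuter_mul {ι : Type} [Fintype ι] (u w : ι → ℝ) (G : Matrix ι ι ℝ) :
    trace (symOuter u w * G) = (1 / 2 : ℝ) * (w ⬝ᵥ G *ᵥ u + u ⬝ᵥ G *ᵥ w) := by
  simp only [symOuter, smul_mul, trace_smul, add_mul, trace_add, trace_mul_comm _ G,
    mul_vecMulVec, trace_vecMulVec, smul_eq_mul, dotProduct_comm]

theorem trace_symOuter_add {ι : Type} [Fintype ι] (u v w : ι → ℝ) (G : Matrix ι ι ℝ) :
    trace (symOuter u (v + w) * G) = trace (symOuter u v * G) + trace (symOuter u w * G) := by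
  simp only [trace_symOuter_mul, add_dotProduct, dotProduct_add, mulVec_add]
  ring

theorem trace_symOuter_sum_smul {ι κ : Type} [Fintype ι] (u : ι → ℝ) (s : Finset κ) (c : κ → ℝ)
    (w : κ → ι → ℝ) (G : Matrix ι ι ℝ) :
    trace (symOuter u (∑ j ∈ s, c j • w j) * G) = ∑ j ∈ s, c j * trace (symOuter u (w j) * G) := by
  classical
  induction s using Finset.induction_on with
  | empty => simp [trace_symOuter_mul]
  | insert k s hk ih =>
    rw [Finset.sum_insert hk, Finset.sum_insert hk, trace_symOuter_add, ih]
    simp only [trace_symOuter_mul, smul_dotProduct, dotProduct_smul, mulVec_smul, smul_eq_mul]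
    ring

theorem inner_sum_smul_sum_smul {E ι : Type} [Fintype ι] [NormedAddCommGroup E]
    [InnerProductSpace ℝ E] (p : ι → E) (u w : ι → ℝ) :
    inner ℝ (∑ i, u i • p i) (∑ i, w i • p i) = u ⬝ᵥ gram ℝ p *ᵥ w := by
  simpa using (star_dotProduct_gram_mulVec (𝕜 := ℝ) p u w).symm

theorem trace_symOuter_mul_gram {E ι : Type} [Fintype ι] [NormedAddCommGroup E]
    [InnerProductSpace ℝ E] (p : ι → E) (u w : ι → ℝ) :
    trace (symOuter u w * gram ℝ p) = inner ℝ (∑ i, u i • p i) (∑ i, w i • p i) := by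
  rw [trace_symOuter_mul, ← inner_sum_smul_sum_smul, ← inner_sum_smul_sum_smul, real_inner_comm]
  ring

/-- The trace splits over the `d` coordinates: the `r`-th summand is the quadratic form of `M` at
the vector of `r`-th coordinates of the `p i`. No symmetry of `M` is needed. -/
theorem PSD.trace_mul_gram_nonneg {ι : Type} [Fintype ι] {d : ℕ} {M : Matrix ι ι ℝ} (hM : PSD M)
    (p : ι → Vec d) : 0 ≤ trace (M * gram ℝ p) := by
  have : trace (M * gram ℝ p) = ∑ r, (fun i => p i r) ⬝ᵥ M *ᵥ (fun i => p i r) := by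
    simp only [trace, diag_apply, mul_apply, gram_apply, PiLp.inner_apply, dotProduct, mulVec,
      Finset.mul_sum]
    conv_rhs => rw [Finset.sum_comm]
    refine Finset.sum_congr rfl fun i _ => ?_
    rw [Finset.sum_comm]
    refine Finset.sum_congr rfl fun j _ => Finset.sum_congr rfl fun r _ => ?_
    simp
    ring
  rw [this]
  exact Finset.sum_nonneg fun r _ => hM _

theorem sum_gVec_smul_cols {d N : ℕ} (x g : StarIdx N → Vec d) (i : Fin (N + 1)) :
    ∑ c, gVec (some i) c • cols x g c = g (some i) := by
  simp [gVec, Pi.single_apply, cols]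

theorem sum_xVec_smul_cols {d N : ℕ} (x g : StarIdx N → Vec d) (i : StarIdx N) :
    ∑ c, xVec i c • cols x g c = x i - x (some 0) := by
  rcases i with _ | i
  · simp [xVec, Pi.single_apply, cols]
  · induction i using Fin.cases with
    | zero => simp [xVec]
    | succ i => simp [xVec, Pi.single_apply, cols]

theorem sum_xVec_sub_smul_cols {d N : ℕ} (x g : StarIdx N → Vec d) (i j : StarIdx N) :
    ∑ c, (xVec i - xVec j) c • cols x g c = x i - x j := by
  simp only [Pi.sub_apply, sub_smul, Finset.sum_sub_distrib, sum_xVec_smul_cols,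
    sub_sub_sub_cancel_right]

/-- Feasibility for the primal semidefinite program, apart from `G ⪰ 0`. -/
structure PrimalFeasible {N : ℕ} {K : Type*} (R : ℝ)
    (A : K → Matrix (GramIdx N) (GramIdx N) ℝ) (a : K → StarIdx N → ℝ) (b : K → ℝ)
    (G : Matrix (GramIdx N) (GramIdx N) ℝ) (F : StarIdx N → ℝ) : Prop where
  interp : ∀ k, trace (A k * G) + a k ⬝ᵥ F + b k ≤ 0
  orth_g : ∀ i j : Fin (N + 1), j < i →
    trace (symOuter (gVec (some i)) (gVec (some j)) * G) = 0
  orth_x : ∀ i j : Fin (N + 1), 0 < j → j ≤ i →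
    trace (symOuter (gVec (some i)) (xVec (some j) - xVec (some 0)) * G) = 0
  dist : trace (symOuter (xVec (some 0) - xVec none) (xVec (some 0) - xVec none) * G) ≤ R ^ 2

theorem primalFeasible_gramMatrix_iff {d N : ℕ} {R : ℝ} (hR : 0 ≤ R)
    {𝓕 : Set (Vec d → EReal)} {K : Type*} {A : K → Matrix (GramIdx N) (GramIdx N) ℝ}
    {a : K → StarIdx N → ℝ} {b : K → ℝ} (hic : EncodesInterpolation 𝓕 A a b)
    {x g : StarIdx N → Vec d} {v : StarIdx N → ℝ} (hg : g none = 0) :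
    PrimalFeasible R A a b (gramMatrix x g) v ↔
      Interpolable 𝓕 x g v ∧
      (∀ i j : Fin (N + 1), j < i → inner ℝ (g (some i)) (g (some j)) = 0) ∧
      (∀ i j : Fin (N + 1), 0 < j → j ≤ i → inner ℝ (g (some i)) (x (some j) - x (some 0)) = 0) ∧
      ‖x (some 0) - x none‖ ≤ R := by
  have hgg : ∀ i j : Fin (N + 1), trace (symOuter (gVec (some i)) (gVec (some j)) *
      gramMatrix x g) = inner ℝ (g (some i)) (g (some j)) := fun i j => by
    rw [gramMatrix, trace_symOuter_mul_gram, sum_gVec_smul_cols, sum_gVec_smul_cols]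
  have hgx : ∀ i j : Fin (N + 1), trace (symOuter (gVec (some i)) (xVec (some j) - xVec (some 0)) *
      gramMatrix x g) = inner ℝ (g (some i)) (x (some j) - x (some 0)) := fun i j => by
    rw [gramMatrix, trace_symOuter_mul_gram, sum_gVec_smul_cols, sum_xVec_sub_smul_cols]
  have hxx : trace (symOuter (xVec (some 0) - xVec none) (xVec (some 0) - xVec none) *
      gramMatrix x g) = ‖x (some 0) - x none‖ ^ 2 := by
    rw [gramMatrix, trace_symOuter_mul_gram, sum_xVec_sub_smul_cols, real_inner_self_eq_norm_sq]
  rw [hic x g v hg]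
  refine ⟨fun h => ⟨h.interp, fun i j hij => hgg i j ▸ h.orth_g i j hij,
    fun i j h0 hij => hgx i j ▸ h.orth_x i j h0 hij, ?_⟩,
    fun ⟨h1, h2, h3, h4⟩ => ⟨h1, fun i j hij => (hgg i j).trans (h2 i j hij),
      fun i j h0 hij => (hgx i j).trans (h3 i j h0 hij), ?_⟩⟩
  · exact (sq_le_sq₀ (norm_nonneg _) hR).1 (hxx ▸ h.dist)
  · rw [hxx]
    exact (sq_le_sq₀ (norm_nonneg _) hR).2 h4

theorem trace_dualMatrix_mul {N : ℕ} {K : Type*} [Fintype K]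
    (A : K → Matrix (GramIdx N) (GramIdx N) ℝ) (α : K → ℝ) (β γ : Fin (N + 1) → Fin (N + 1) → ℝ)
    (τ : ℝ) (G : Matrix (GramIdx N) (GramIdx N) ℝ) :
    trace (dualMatrix A α β γ τ * G) = ∑ k, α k * trace (A k * G)
      + ∑ i ∈ Finset.Ioi (0 : Fin (N + 1)),
        (∑ j ∈ Finset.Iio i, β i j * trace (symOuter (gVec (some i)) (gVec (some j)) * G)
          + ∑ j ∈ Finset.Ioc 0 i, γ i j *
            trace (symOuter (gVec (some i)) (xVec (some j) - xVec (some 0)) * G))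
      + τ * trace (symOuter (xVec (some 0) - xVec none) (xVec (some 0) - xVec none) * G) := by
  simp only [dualMatrix, add_mul, Finset.sum_mul, trace_add, trace_sum, smul_mul, trace_smul,
    smul_eq_mul, trace_symOuter_add, trace_symOuter_sum_smul]

/-- In the pairing of the dual matrix with `G` the `β` and `γ` terms vanish by orthogonality, and
the affine dual constraint rewrites the objective through the `a k`. What remains is a nonnegative
combination of the primal inequalities. -/
theorem weak_duality {N : ℕ} {K : Type*} [Fintype K] {R : ℝ}
    {A : K → Matrix (GramIdx N) (GramIdx N) ℝ} {a : K → StarIdx N → ℝ} {b : K → ℝ}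
    {α : K → ℝ} {β γ : Fin (N + 1) → Fin (N + 1) → ℝ} {τ : ℝ}
    {G : Matrix (GramIdx N) (GramIdx N) ℝ} {F : StarIdx N → ℝ}
    (hD : DualFeasible A a α β γ τ) (hP : PrimalFeasible R A a b G F)
    (hG : 0 ≤ trace (dualMatrix A α β γ τ * G)) :
    F (some (Fin.last N)) - F none ≤ τ * R ^ 2 - ∑ k, α k * b k := by
  have h1 : F (some (Fin.last N)) - F none = ∑ k, α k * (a k ⬝ᵥ F) := by
    have := congrArg (· ⬝ᵥ F) hD.affine
    simp only [sub_dotProduct, sum_dotProduct, smul_dotProduct, fVec, single_one_dotProduct,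
      zero_dotProduct, smul_eq_mul] at this
    linarith
  rw [trace_dualMatrix_mul, Finset.sum_eq_zero (s := Finset.Ioi 0) fun i _ => by
    rw [Finset.sum_eq_zero fun j hj => by rw [hP.orth_g i j (Finset.mem_Iio.1 hj), mul_zero],
      Finset.sum_eq_zero fun j hj => by
        rw [hP.orth_x i j (Finset.mem_Ioc.1 hj).1 (Finset.mem_Ioc.1 hj).2, mul_zero],
      add_zero]] at hG
  have h2 := mul_le_mul_of_nonneg_left hP.dist hD.τ_nonneg
  have h3 : ∑ k, α k * (trace (A k * G) + a k ⬝ᵥ F + b k) ≤ 0 :=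
    Finset.sum_nonpos fun k _ => mul_nonpos_of_nonneg_of_nonpos (hD.α_nonneg k) (hP.interp k)
  simp only [mul_add, Finset.sum_add_distrib] at h3
  linarith

theorem convex_primalFeasible {N : ℕ} {K : Type*} (R : ℝ)
    (A : K → Matrix (GramIdx N) (GramIdx N) ℝ) (a : K → StarIdx N → ℝ) (b : K → ℝ) :
    Convex ℝ {y : Matrix (GramIdx N) (GramIdx N) ℝ × (StarIdx N → ℝ) |
      PrimalFeasible R A a b y.1 y.2} := by
  rintro ⟨G, F⟩ hG ⟨G', F'⟩ hG' s t hs ht hst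
  refine ⟨fun k => ?_, fun i j hij => ?_, fun i j h0 hij => ?_, ?_⟩ <;>
    simp only [Prod.smul_mk, Prod.mk_add_mk, mul_add, trace_add, Matrix.mul_smul, trace_smul,
      dotProduct_add, dotProduct_smul, smul_eq_mul]
  · have h1 := mul_nonpos_of_nonneg_of_nonpos hs (hG.interp k)
    have h2 := mul_nonpos_of_nonneg_of_nonpos ht (hG'.interp k)
    have h3 : b k = s * b k + t * b k := by rw [← add_mul, hst, one_mul]
    simp only at h1 h2
    linarith
  · have h1 := hG.orth_g i j hij
    have h2 := hG'.orth_g i j hij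
    simp only at h1 h2
    rw [h1, h2]; simp
  · have h1 := hG.orth_x i j h0 hij
    have h2 := hG'.orth_x i j h0 hij
    simp only at h1 h2
    rw [h1, h2]; simp
  · have h1 := mul_le_mul_of_nonneg_left hG.dist hs
    have h2 := mul_le_mul_of_nonneg_left hG'.dist ht
    have h3 : R ^ 2 = s * R ^ 2 + t * R ^ 2 := by rw [← add_mul, hst, one_mul]
    simp only at h1 h2
    linarith

end PEP

/-! ### Strong duality for the semidefinite program. -/

namespace PEP

open Matrix

/-- By homogeneity positivity need only be tested on the unit sphere, whose compactness makes the
condition open. -/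
theorem isOpen_setOf_quadraticForm_pos {n : Type} [Fintype n] :
    IsOpen {M : Matrix n n ℝ | ∀ v : n → ℝ, v ≠ 0 → 0 < v ⬝ᵥ M *ᵥ v} := by
  have h : {M : Matrix n n ℝ | ∀ v : n → ℝ, v ≠ 0 → 0 < v ⬝ᵥ M *ᵥ v}
      = {M | ∀ v ∈ Metric.sphere (0 : n → ℝ) 1, 0 < v ⬝ᵥ M *ᵥ v} := by
    ext M
    refine ⟨fun h v hv => h v (ne_zero_of_mem_unit_sphere ⟨v, hv⟩), fun h v hv => ?_⟩
    have h0 : 0 < ‖v‖ := norm_pos_iff.2 hv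
    have h1 := h (‖v‖⁻¹ • v) (by simp [norm_smul, h0.ne'])
    rw [mulVec_smul, smul_dotProduct, dotProduct_smul, smul_eq_mul, smul_eq_mul] at h1
    exact (mul_pos_iff_of_pos_left (inv_pos.2 h0)).1 ((mul_pos_iff_of_pos_left (inv_pos.2 h0)).1 h1)
  rw [h, isOpen_iff_eventually]
  intro M hM
  refine (isCompact_sphere _ _).eventually_forall_of_forall_eventually fun v hv => ?_
  have hc : Continuous fun z : Matrix n n ℝ × (n → ℝ) => z.2 ⬝ᵥ z.1 *ᵥ z.2 := by fun_prop
  exact hc.continuousAt.eventually (lt_mem_nhds (hM v hv))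

theorem nonneg_of_forall_pos_add_mul_nonneg {p q : ℝ} (h : ∀ t : ℝ, 0 < t → 0 ≤ p + t * q) :
    0 ≤ p := by
  refine ge_of_tendsto (f := fun t : ℝ => p + t * q) (x := nhdsWithin 0 (Set.Ioi 0)) ?_
    (eventually_nhdsWithin_of_forall h)
  have : Continuous fun t : ℝ => p + t * q := by fun_prop
  simpa using (this.tendsto 0).mono_left nhdsWithin_le_nhds

/-- Strong duality for the semidefinite program, under the existence of a positive definite
feasible point. -/
theorem strong_duality {N : ℕ} {K : Type*} [Fintype K] {R : ℝ}
    {A : K → Matrix (GramIdx N) (GramIdx N) ℝ} {a : K → StarIdx N → ℝ} {b : K → ℝ} {p : ℝ}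
    (hS : ∃ G F, G.PosDef ∧ PrimalFeasible R A a b G F)
    (hp : ∀ G F, G.PosDef → PrimalFeasible R A a b G F →
      F (some (Fin.last N)) - F none ≤ p) :
    ∃ (α : K → ℝ) (β γ : Fin (N + 1) → Fin (N + 1) → ℝ) (τ : ℝ),
      DualFeasible A a α β γ τ ∧ τ * R ^ 2 - ∑ k, α k * b k ≤ p := by
  -- Positive definite matrices are symmetric, hence not open among all matrices. The cone `U` drops
  -- symmetry, and every functional is evaluated on the symmetric part instead.
  let S : Matrix (GramIdx N) (GramIdx N) ℝ → Matrix (GramIdx N) (GramIdx N) ℝ :=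
    fun G => (1 / 2 : ℝ) • (G + Gᵀ)
  have hSsymm : ∀ G : Matrix (GramIdx N) (GramIdx N) ℝ, G.IsHermitian → S G = G := fun G hG => by
    have : Gᵀ = G := by simpa [IsHermitian, conjTranspose_eq_transpose_of_trivial] using hG
    simp only [S, this, ← two_smul ℝ G, smul_smul]
    norm_num
  let T : Matrix (GramIdx N) (GramIdx N) ℝ →
      Matrix (GramIdx N) (GramIdx N) ℝ × (StarIdx N → ℝ) →ₗ[ℝ] ℝ := fun M =>
    { toFun := fun y => trace (M * S y.1)
      map_add' := fun y z => by
        simp only [S, Prod.fst_add, transpose_add, mul_add, smul_add, trace_add]; ring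
      map_smul' := fun c y => by
        simp only [S, Prod.smul_fst, transpose_smul, mul_add, smul_add, trace_add, Matrix.mul_smul,
          trace_smul, smul_eq_mul, RingHom.id_apply]; ring }
  have hT : ∀ M y, T M y = trace (M * S y.1) := fun _ _ => rfl
  let D : (StarIdx N → ℝ) →
      Matrix (GramIdx N) (GramIdx N) ℝ × (StarIdx N → ℝ) →ₗ[ℝ] ℝ := fun u =>
    { toFun := fun y => u ⬝ᵥ y.2
      map_add' := fun y z => by simp
      map_smul' := fun c y => by simp }
  have hD : ∀ u y, D u y = u ⬝ᵥ y.2 := fun _ _ => rfl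
  let U : Set (Matrix (GramIdx N) (GramIdx N) ℝ × (StarIdx N → ℝ)) :=
    {y | ∀ v : GramIdx N → ℝ, v ≠ 0 → 0 < v ⬝ᵥ y.1 *ᵥ v}
  have hUo : IsOpen U := isOpen_setOf_quadraticForm_pos.preimage continuous_fst
  have hUt : ∀ t : ℝ, 0 < t → ∀ y ∈ U, t • y ∈ U := fun t ht y hy v hv => by
    simp only [Prod.smul_fst, smul_mulVec, dotProduct_smul, smul_eq_mul]
    exact mul_pos ht (hy v hv)
  have hUa : ∀ y ∈ U, ∀ z ∈ U, y + z ∈ U := fun y hy z hz v hv => by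
    simp only [Prod.fst_add, add_mulVec, dotProduct_add]
    exact add_pos (hy v hv) (hz v hv)
  have hUc : Convex ℝ U := convex_iff_forall_pos.2 fun y hy z hz s t hs ht _ =>
    hUa _ (hUt s hs y hy) _ (hUt t ht z hz)
  have hUS : ∀ y ∈ U, (S y.1).PosDef := fun y hy => by
    refine PosDef.of_dotProduct_mulVec_pos ?_ fun v hv => ?_
    · rw [IsHermitian, conjTranspose_eq_transpose_of_trivial]
      simp only [S, transpose_smul, transpose_add, transpose_transpose, add_comm]
    · simp only [S, smul_mulVec, add_mulVec, dotProduct_smul, dotProduct_add, smul_eq_mul,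
        star_trivial]
      have h1 := hy v hv
      have h2 : v ⬝ᵥ y.1ᵀ *ᵥ v = v ⬝ᵥ y.1 *ᵥ v := by
        rw [mulVec_transpose, dotProduct_comm, ← dotProduct_mulVec]
      rw [h2]
      linarith
  have hPU : ∀ G : Matrix (GramIdx N) (GramIdx N) ℝ, ∀ F, G.PosDef → (G, F) ∈ U :=
    fun G F hG v hv => by simpa using hG.dotProduct_mulVec_pos hv
  let ℓ : Option K → Matrix (GramIdx N) (GramIdx N) ℝ × (StarIdx N → ℝ) →ₗ[ℝ] ℝ := fun o =>
    o.elim (T (symOuter (xVec (some 0) - xVec none) (xVec (some 0) - xVec none)))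
      fun k => T (A k) + D (a k)
  let c : Option K → ℝ := fun o => o.elim (R ^ 2) fun k => -b k
  -- All pairs serve as indices; the zero functional stands for pairs outside the two ranges.
  let m : (Fin (N + 1) × Fin (N + 1)) ⊕ (Fin (N + 1) × Fin (N + 1)) →
      Matrix (GramIdx N) (GramIdx N) ℝ × (StarIdx N → ℝ) →ₗ[ℝ] ℝ :=
    Sum.elim
      (fun q => if q.2 < q.1 then T (symOuter (gVec (some q.1)) (gVec (some q.2))) else 0)
      (fun q => if 0 < q.2 ∧ q.2 ≤ q.1 then
        T (symOuter (gVec (some q.1)) (xVec (some q.2) - xVec (some 0))) else 0)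
  let φ : Matrix (GramIdx N) (GramIdx N) ℝ × (StarIdx N → ℝ) →ₗ[ℝ] ℝ :=
    D (fVec (some (Fin.last N)) - fVec none)
  have hφ : ∀ y, φ y = y.2 (some (Fin.last N)) - y.2 none := fun y => by
    simp only [φ, hD, sub_dotProduct, fVec, single_one_dotProduct]
  have hfeas : ∀ y, (∀ i, ℓ i y ≤ c i) ∧ (∀ j, m j y = 0) ↔
      PrimalFeasible R A a b (S y.1) y.2 := fun y => by
    constructor
    · rintro ⟨h1, h2⟩
      refine ⟨fun k => ?_, fun i j hij => ?_, fun i j h0 hij => ?_, h1 none⟩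
      · have h3 : trace (A k * S y.1) + a k ⬝ᵥ y.2 ≤ -b k := h1 (some k)
        linarith
      · simpa [m, hij, hT] using h2 (.inl (i, j))
      · simpa [m, h0, hij, hT] using h2 (.inr (i, j))
    · intro h
      refine ⟨fun o => ?_, fun j => ?_⟩
      · cases o with
        | none => exact h.dist
        | some k =>
          have h3 : trace (A k * S y.1) + a k ⬝ᵥ y.2 ≤ -b k := by linarith [h.interp k]
          exact h3
      · rcases j with ⟨i, j⟩ | ⟨i, j⟩
        · by_cases hij : j < i
          · simpa [m, hij, hT] using h.orth_g i j hij
          · simp [m, hij]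
        · by_cases hij : 0 < j ∧ j ≤ i
          · simpa [m, hij, hT] using h.orth_x i j hij.1 hij.2
          · simp [m, hij]
  obtain ⟨r, s, hr, hrp, hU⟩ := exists_multipliers_of_le_on_open_cone hUo hUc hUt ℓ c m φ p
    (by
      obtain ⟨G, F, hG, hF⟩ := hS
      exact ⟨(G, F), hPU G F hG, (hfeas _).2 (by simpa only [hSsymm G hG.1] using hF)⟩)
    (fun y hy h1 h2 => hφ y ▸ hp _ _ (hUS y hy) ((hfeas y).1 ⟨h1, h2⟩))
  let α : K → ℝ := fun k => r (some k)
  let β : Fin (N + 1) → Fin (N + 1) → ℝ := fun i j => s (.inl (i, j))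
  let γ : Fin (N + 1) → Fin (N + 1) → ℝ := fun i j => s (.inr (i, j))
  let q : StarIdx N → ℝ := fVec (some (Fin.last N)) - fVec none - ∑ k, α k • a k
  have hrhs : ∀ y, ∑ i, r i * ℓ i y + ∑ j, s j * m j y
      = trace (dualMatrix A α β γ (r none) * S y.1) + (∑ k, α k • a k) ⬝ᵥ y.2 := fun y => by
    have e1 : ∑ x : Fin (N + 1) × Fin (N + 1), s (.inl x) * m (.inl x) y
        = ∑ i ∈ Finset.Ioi (0 : Fin (N + 1)), ∑ j ∈ Finset.Iio i,
          β i j * trace (symOuter (gVec (some i)) (gVec (some j)) * S y.1) := by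
      rw [Fintype.sum_prod_type]
      symm
      refine Finset.sum_subset_zero_on_sdiff (Finset.subset_univ _) (fun i hi => ?_) fun i _ => ?_
      · refine Finset.sum_eq_zero fun j _ => ?_
        have : ¬ j < i := fun hji => (Finset.mem_sdiff.1 hi).2
          (Finset.mem_Ioi.2 ((Fin.zero_le j).trans_lt hji))
        simp [m, this]
      · refine Finset.sum_subset_zero_on_sdiff (Finset.subset_univ _) (fun j hj => ?_) fun j hj => ?_
        · have : ¬ j < i := fun hji => (Finset.mem_sdiff.1 hj).2 (Finset.mem_Iio.2 hji)
          simp [m, this]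
        · simp [m, β, Finset.mem_Iio.1 hj, hT]
    have e2 : ∑ x : Fin (N + 1) × Fin (N + 1), s (.inr x) * m (.inr x) y
        = ∑ i ∈ Finset.Ioi (0 : Fin (N + 1)), ∑ j ∈ Finset.Ioc 0 i,
          γ i j * trace (symOuter (gVec (some i)) (xVec (some j) - xVec (some 0)) * S y.1) := by
      rw [Fintype.sum_prod_type]
      symm
      refine Finset.sum_subset_zero_on_sdiff (Finset.subset_univ _) (fun i hi => ?_) fun i _ => ?_
      · refine Finset.sum_eq_zero fun j _ => ?_
        have : ¬ (0 < j ∧ j ≤ i) := fun hji => (Finset.mem_sdiff.1 hi).2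
          (Finset.mem_Ioi.2 (hji.1.trans_le hji.2))
        simp only [m, Sum.elim_inr, if_neg this, LinearMap.zero_apply, mul_zero]
      · refine Finset.sum_subset_zero_on_sdiff (Finset.subset_univ _) (fun j hj => ?_) fun j hj => ?_
        · have : ¬ (0 < j ∧ j ≤ i) := fun hji => (Finset.mem_sdiff.1 hj).2 (Finset.mem_Ioc.2 hji)
          simp only [m, Sum.elim_inr, if_neg this, LinearMap.zero_apply, mul_zero]
        · simp only [m, γ, Sum.elim_inr, if_pos (Finset.mem_Ioc.1 hj), hT]
    rw [trace_dualMatrix_mul, Fintype.sum_option, Fintype.sum_sum_type, e1, e2,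
      Finset.sum_add_distrib, sum_dotProduct]
    simp only [ℓ, Option.elim, LinearMap.add_apply, hT, hD, mul_add, Finset.sum_add_distrib,
      smul_dotProduct, smul_eq_mul, α]
    ring
  have hmain : ∀ G F, G.PosDef → 0 ≤ trace (dualMatrix A α β γ (r none) * G) - q ⬝ᵥ F :=
    fun G F hG => by
    have h1 := hU _ (hPU G F hG)
    rw [hrhs, hSsymm G hG.1] at h1
    have h2 : q ⬝ᵥ F = φ (G, F) - (∑ k, α k • a k) ⬝ᵥ F := by
      simp only [q, φ, hD, sub_dotProduct]
    simp only at h1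
    linarith
  have hq : q = 0 := by
    -- `F` is unconstrained in `hmain`: taking `F = q` and `G = t • 1` with `t → 0` leaves only `-(q
    -- ⬝ᵥ q)`.
    have h1 : 0 ≤ -(q ⬝ᵥ q) := nonneg_of_forall_pos_add_mul_nonneg
      (q := trace (dualMatrix A α β γ (r none) * 1)) fun t ht => by
        have := hmain (t • 1) q (PosDef.one.smul ht)
        rw [Matrix.mul_smul, trace_smul, smul_eq_mul] at this
        linarith
    exact dotProduct_self_eq_zero.1 (le_antisymm (by linarith) (by
      rw [dotProduct]; exact Finset.sum_nonneg fun i _ => mul_self_nonneg _))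
  refine ⟨α, β, γ, r none, ⟨fun k => hr _, hr none, fun v => ?_, hq⟩, ?_⟩
  · refine nonneg_of_forall_pos_add_mul_nonneg
      (q := trace (dualMatrix A α β γ (r none) * 1)) fun t ht => ?_
    -- The rank-one matrix `v vᵀ`, which turns the trace into the quadratic form at `v`, is a limit
    -- of positive definite matrices.
    have h1 : (vecMulVec v v + t • (1 : Matrix (GramIdx N) (GramIdx N) ℝ)).PosDef :=
      PosDef.posSemidef_add (by simpa using posSemidef_vecMulVec_self_star v) (PosDef.one.smul ht)
    have := hmain _ 0 h1
    rw [mul_add, trace_add, Matrix.mul_smul, trace_smul, smul_eq_mul, mul_vecMulVec,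
      trace_vecMulVec, dotProduct_zero, sub_zero, dotProduct_comm] at this
    exact this
  · simp only [Fintype.sum_option, c, Option.elim, mul_neg, Finset.sum_neg_distrib] at hrp
    simp only [α]
    linarith

end PEP

/-! ### From feasible Gram matrices to executions. -/

namespace PEP

open Matrix
open scoped MatrixOrder in
-- Write `G = Bᵀ B` and place the columns of `B` in `ℝ^d` along distinct basis vectors; this is
-- where the dimension bound enters.
theorem exists_gram_eq {n : Type} [Fintype n] {d : ℕ} (h : Fintype.card n ≤ d) {G : Matrix n n ℝ}
    (hG : G.PosSemidef) : ∃ p : n → Vec d, gram ℝ p = G := by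
  classical
  obtain ⟨B, rfl⟩ := CStarAlgebra.nonneg_iff_eq_star_mul_self.mp hG.nonneg
  obtain ⟨e⟩ : Nonempty (n ↪ Fin d) := Function.Embedding.nonempty_of_card_le (by simpa using h)
  have ho : Orthonormal ℝ fun c : n => EuclideanSpace.basisFun (Fin d) ℝ (e c) :=
    (EuclideanSpace.basisFun (Fin d) ℝ).orthonormal.comp e e.injective
  refine ⟨fun j => ∑ c, B c j • EuclideanSpace.basisFun (Fin d) ℝ (e c), ?_⟩
  ext i j
  rw [gram_apply, ho.inner_sum, star_eq_conjTranspose, mul_apply]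
  simp

/-- Pairing an expansion of `w` with `g j`, `j ∉ S`, leaves the `j`-th coefficient times `‖g j‖ ^
2`, so the `j`-th term is zero even when `g j = 0`. -/
theorem mem_span_image_of_orthogonal {E ι : Type*} [NormedAddCommGroup E] [InnerProductSpace ℝ E]
    [Fintype ι] {g : ι → E} (hg : ∀ i j, i ≠ j → inner ℝ (g i) (g j) = 0) {S : Set ι} {w : E}
    (hw : w ∈ Submodule.span ℝ (Set.range g)) (h : ∀ j ∉ S, inner ℝ (g j) w = 0) :
    w ∈ Submodule.span ℝ (g '' S) := by
  obtain ⟨c, rfl⟩ := (Submodule.mem_span_range_iff_exists_fun ℝ).1 hw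
  refine Submodule.sum_mem _ fun j _ => ?_
  by_cases hj : j ∈ S
  · exact Submodule.smul_mem _ _ (Submodule.subset_span ⟨j, hj, rfl⟩)
  · have h1 := h j hj
    rw [inner_sum, Finset.sum_eq_single j (fun i _ hij => by
      rw [real_inner_smul_right, hg j i hij.symm, mul_zero]) (by simp), real_inner_smul_right,
      mul_eq_zero, inner_self_eq_zero] at h1
    rcases h1 with h1 | h1 <;> simp [h1]

theorem inner_eq_zero_of_mem_span {E : Type*} [NormedAddCommGroup E] [InnerProductSpace ℝ E]
    {s : Set E} {u w : E} (h : ∀ z ∈ s, inner ℝ u z = 0) (hw : w ∈ Submodule.span ℝ s) :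
    inner ℝ u w = 0 := by
  have : Submodule.span ℝ s ≤ LinearMap.ker (innerₛₗ ℝ u) :=
    Submodule.span_le.2 fun z hz => by simpa using h z hz
  simpa using this hw

theorem isSubgradient_zero_iff {d : ℕ} {f : Vec d → EReal} {x : Vec d} :
    IsSubgradient f x 0 ↔ ∀ y, f x ≤ f y := by
  simp [IsSubgradient]

theorem IsCCP.coe_toReal_of_isSubgradient {d : ℕ} {f : Vec d → EReal} (hf : IsCCP f)
    {x g : Vec d} (h : IsSubgradient f x g) : ((f x).toReal : EReal) = f x := by
  refine EReal.coe_toReal (fun htop => ?_) (hf.ne_bot x)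
  obtain ⟨y, hy⟩ := hf.exists_ne_top
  have := h y
  rw [htop, EReal.top_add_coe, top_le_iff] at this
  exact hy this

theorem inaccuracy_eq {d : ℕ} {f : Vec d → EReal} {y xs : Vec d} {v w : ℝ}
    (hs : ∀ z, f xs ≤ f z) (hy : f y = v) (hxs : f xs = w) :
    inaccuracy f y = ((v - w : ℝ) : EReal) := by
  have : ⨅ z, f z = f xs := le_antisymm (iInf_le _ _) (le_iInf hs)
  rw [inaccuracy, this, hy, hxs, EReal.coe_sub]

/-- A family satisfying the conditions of the primal program yields, after projecting the points
onto the span of the subgradients, an execution of the method. -/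
theorem exists_run_of_interpolable {d N : ℕ} {R : ℝ} {𝓕 : Set (Vec d → EReal)}
    (hc : ContractionPreserving 𝓕) {x g : StarIdx N → Vec d} {v : StarIdx N → ℝ}
    (hg : g none = 0) (hi : Interpolable 𝓕 x g v)
    (hgg : ∀ i j : Fin (N + 1), j < i → inner ℝ (g (some i)) (g (some j)) = 0)
    (hgx : ∀ i j : Fin (N + 1), 0 < j → j ≤ i →
      inner ℝ (g (some i)) (x (some j) - x (some 0)) = 0)
    (hR : ‖x (some 0) - x none‖ ≤ R) :
    ∃ (f : Vec d → EReal) (x₀ y : Vec d), IsInput 𝓕 R f x₀ ∧ IsGFOMOutput f x₀ N y ∧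
      inaccuracy f y = ((v (some (Fin.last N)) - v none : ℝ) : EReal) := by
  have hne : ∀ i j : Fin (N + 1), i ≠ j → inner ℝ (g (some i)) (g (some j)) = 0 :=
    fun i j hij => by
      rcases lt_or_gt_of_ne hij with h | h
      · rw [real_inner_comm]; exact hgg j i h
      · exact hgg i j h
  let V : Submodule ℝ (Vec d) := Submodule.span ℝ (Set.range fun i : Fin (N + 1) => g (some i))
  have hgV : ∀ j, g j ∈ V := fun j => by
    rcases j with _ | j
    · rw [hg]; exact V.zero_mem
    · exact Submodule.subset_span ⟨j, rfl⟩
  have hproj : ∀ j w, inner ℝ (g j) (V.starProjection w) = inner ℝ (g j) w := fun j w => by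
    rw [← Submodule.inner_starProjection_left_eq_right,
      Submodule.starProjection_eq_self_iff.2 (hgV j)]
  let x' : StarIdx N → Vec d := fun i => x (some 0) + V.starProjection (x i - x (some 0))
  have hsub : ∀ i j, x' i - x' j = V.starProjection (x i - x j) := fun i j => by
    simp only [x', add_sub_add_left_eq_sub, ← map_sub, sub_sub_sub_cancel_right]
  -- Projection onto `V` is nonexpansive and does not change products with vectors of `V`: exactly
  -- the two hypotheses of contraction preservation.
  obtain ⟨f, hf, hsg⟩ := hc _ x g v x' hi
    (fun i j => by rw [hsub]; exact V.norm_starProjection_apply_le _)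
    (fun i j => by rw [hsub, hproj])
  have hmin : ∀ y, f (x' none) ≤ f y := isSubgradient_zero_iff.1 (hg ▸ (hsg none).1)
  refine ⟨f, x' (some 0), x' (some (Fin.last N)), ⟨hf, x' none, hmin, ?_⟩, ?_,
    inaccuracy_eq hmin (hsg _).2 (hsg _).2⟩
  · rw [hsub]
    exact (V.norm_starProjection_apply_le _).trans hR
  let X : ℕ → Vec d := fun n => if h : n < N + 1 then x' (some ⟨n, h⟩) else 0
  let Γ : ℕ → Vec d := fun n => if h : n < N + 1 then g (some ⟨n, h⟩) else 0
  have hX : ∀ i : Fin (N + 1), X i = x' (some i) := fun i => dif_pos i.2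
  have hΓ : ∀ i : Fin (N + 1), Γ i = g (some i) := fun i => dif_pos i.2
  have himage : ∀ i : Fin (N + 1), Γ '' Set.Iio (i : ℕ) = (fun j => g (some j)) '' Set.Iio i := by
    intro i
    ext z
    constructor
    · rintro ⟨j, hj, rfl⟩
      exact ⟨⟨j, lt_trans hj i.2⟩, hj, (hΓ ⟨j, lt_trans hj i.2⟩).symm⟩
    · rintro ⟨j, hj, rfl⟩
      exact ⟨j, hj, hΓ j⟩
  have hmem : ∀ i : Fin (N + 1), 0 < i →
      x' (some i) - x' (some 0) ∈ Submodule.span ℝ (Γ '' Set.Iio (i : ℕ)) := fun i hi => by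
    rw [himage]
    -- After projection the displacement lies in the span of all subgradients, and it is orthogonal
    -- to those of index at least `i`; only the earlier ones remain.
    refine mem_span_image_of_orthogonal hne ?_ fun j hj => ?_
    · rw [hsub]
      exact V.starProjection_apply_mem _
    · rw [hsub, hproj]
      exact hgx j i hi (not_lt.1 hj)
  refine ⟨X, Γ, ⟨?_, fun i hi => ?_, fun i h1 hi => ?_, fun i h1 hi y hy => ?_,
    fun i h1 hi j hj => ?_⟩, hX (Fin.last N)⟩
  · exact hX 0
  · have := (hsg (some ⟨i, Nat.lt_succ_of_le hi⟩)).1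
    rwa [← hX, ← hΓ] at this
  · have := hmem ⟨i, Nat.lt_succ_of_le hi⟩ h1
    rwa [← hX ⟨i, _⟩] at this
  · have h2 := hmem ⟨i, Nat.lt_succ_of_le hi⟩ h1
    -- Minimality over the affine search space: differences inside it are orthogonal to the current
    -- subgradient, so the subgradient inequality loses its linear term.
    have h3 : inner ℝ (g (some ⟨i, Nat.lt_succ_of_le hi⟩))
        (y - x' (some ⟨i, Nat.lt_succ_of_le hi⟩)) = 0 := by
      refine inner_eq_zero_of_mem_span (s := Γ '' Set.Iio i) ?_ ?_
      · rw [himage ⟨i, Nat.lt_succ_of_le hi⟩]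
        rintro _ ⟨j, hj, rfl⟩
        exact hgg _ j hj
      · simpa using Submodule.sub_mem _ hy h2
    have h4 := (hsg (some ⟨i, Nat.lt_succ_of_le hi⟩)).1 y
    rw [h3, EReal.coe_zero, add_zero, ← hX] at h4
    exact h4
  · have := hgg ⟨i, Nat.lt_succ_of_le hi⟩ ⟨j, by omega⟩ hj
    rwa [← hΓ, ← hΓ] at this

theorem exists_run_of_primalFeasible {d N : ℕ} {R : ℝ} (hR : 0 ≤ R) (hd : 2 * N + 2 ≤ d)
    {𝓕 : Set (Vec d → EReal)} (hc : ContractionPreserving 𝓕) {K : Type*}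
    {A : K → Matrix (GramIdx N) (GramIdx N) ℝ} {a : K → StarIdx N → ℝ} {b : K → ℝ}
    (hic : EncodesInterpolation 𝓕 A a b)
    {G : Matrix (GramIdx N) (GramIdx N) ℝ} {F : StarIdx N → ℝ} (hG : G.PosSemidef)
    (hF : PrimalFeasible R A a b G F) :
    ∃ (f : Vec d → EReal) (x₀ y : Vec d), IsInput 𝓕 R f x₀ ∧ IsGFOMOutput f x₀ N y ∧
      inaccuracy f y = ((F (some (Fin.last N)) - F none : ℝ) : EReal) := by
  obtain ⟨p, rfl⟩ := exists_gram_eq ((card_gramIdx N).trans_le hd) hG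
  let x : StarIdx N → Vec d := fun o => o.elim (p (.inr (.inr ())))
    (Fin.cases 0 fun j => p (.inr (.inl j)))
  let g : StarIdx N → Vec d := fun o => o.elim 0 fun i => p (.inl i)
  have hp : gramMatrix x g = gram ℝ p := by
    rw [gramMatrix]
    congr 1
    funext c
    rcases c with i | j | _ <;> simp [cols, x, g]
  have hg : g none = 0 := rfl
  rw [← hp, primalFeasible_gramMatrix_iff hR hic hg] at hF
  exact exists_run_of_interpolable hc hg hF.1 hF.2.1 hF.2.2.1 hF.2.2.2

/-! ### Truncated executions and the Slater point. -/

/-- The points `x 0, …, x m`, followed by copies of the minimizer `xs`. -/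
def truncPoints {d : ℕ} (N m : ℕ) (x : ℕ → Vec d) (xs : Vec d) : StarIdx N → Vec d
  | none => xs
  | some j => if (j : ℕ) ≤ m then x j else xs

/-- The subgradients `g 0, …, g m`, followed by zeros. -/
def truncGrads {d : ℕ} (N m : ℕ) (g : ℕ → Vec d) : StarIdx N → Vec d
  | none => 0
  | some j => if (j : ℕ) ≤ m then g j else 0

theorem IsGFOMRun.inner_sub_eq_zero {d n : ℕ} {f : Vec d → EReal} {x₀ : Vec d} {x g : ℕ → Vec d}
    (h : IsGFOMRun f x₀ n x g) {i j : ℕ} (hi : i ≤ n) (hji : j ≤ i) :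
    inner ℝ (g i) (x j - x₀) = 0 := by
  rcases Nat.eq_zero_or_pos j with rfl | hj
  · simp [h.start]
  · refine inner_eq_zero_of_mem_span ?_ (h.mem j hj (hji.trans hi))
    rintro _ ⟨k, hk, rfl⟩
    have hk : k < j := hk
    exact h.orth i (by omega) hi k (by omega)

/-- Padding is harmless because a minimizer has subgradient zero, which satisfies every
orthogonality relation. The case `m = N` serves the upper bound, and all `m ≤ N` together serve the
Slater point. -/
theorem IsGFOMRun.primalFeasible_trunc {d N n m : ℕ} {R : ℝ} (hR : 0 ≤ R)
    {𝓕 : Set (Vec d → EReal)} {K : Type*}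
    {A : K → Matrix (GramIdx N) (GramIdx N) ℝ} {a : K → StarIdx N → ℝ} {b : K → ℝ}
    (hic : EncodesInterpolation 𝓕 A a b)
    {f : Vec d → EReal} {x₀ xs : Vec d} {x g : ℕ → Vec d}
    (hf : f ∈ 𝓕) (hccp : IsCCP f) (hs : ∀ y, f xs ≤ f y) (hxs : ‖x₀ - xs‖ ≤ R)
    (h : IsGFOMRun f x₀ n x g) (hm : m ≤ n) :
    PrimalFeasible R A a b (gramMatrix (truncPoints N m x xs) (truncGrads N m g))
      fun i => (f (truncPoints N m x xs i)).toReal := by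
  have h0 : truncPoints N m x xs (some 0) = x₀ := by simp [truncPoints, h.start]
  have hsub : ∀ i, IsSubgradient f (truncPoints N m x xs i) (truncGrads N m g i) := fun i => by
    rcases i with _ | i
    · exact isSubgradient_zero_iff.2 hs
    · by_cases hi : (i : ℕ) ≤ m
      · simpa [truncPoints, truncGrads, hi] using h.subgrad i (hi.trans hm)
      · simpa [truncPoints, truncGrads, hi] using isSubgradient_zero_iff.2 hs
  refine (primalFeasible_gramMatrix_iff hR hic rfl).2 ⟨⟨f, hf, fun i => ⟨hsub i,
    (hccp.coe_toReal_of_isSubgradient (hsub i)).symm⟩⟩, fun i j hij => ?_, fun i j _ hij => ?_, ?_⟩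
  · by_cases hi : (i : ℕ) ≤ m
    · have hij' : (j : ℕ) < i := hij
      have hj : (j : ℕ) ≤ m := by omega
      simpa [truncGrads, hi, hj] using h.orth i (by omega) (hi.trans hm) j hij'
    · simp [truncGrads, hi]
  · by_cases hi : (i : ℕ) ≤ m
    · have hij' : (j : ℕ) ≤ i := hij
      have hj : (j : ℕ) ≤ m := by omega
      rw [h0]
      simpa [truncGrads, truncPoints, hi, hj] using h.inner_sub_eq_zero (hi.trans hm) hij'
    · simp [truncGrads, hi]
  · rw [h0]
    exact hxs

theorem IsGFOMRun.le_of_le {d n : ℕ} {f : Vec d → EReal} {x₀ : Vec d} {x g : ℕ → Vec d}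
    (h : IsGFOMRun f x₀ n x g) {i : ℕ} (hi : i ≤ n) : f (x n) ≤ f (x i) := by
  rcases hi.eq_or_lt with rfl | hlt
  · exact le_rfl
  refine h.isMin n (by omega) le_rfl _ ?_
  rcases Nat.eq_zero_or_pos i with rfl | hpos
  · simp [h.start]
  · exact Submodule.span_mono (Set.image_mono (Set.Iio_subset_Iio hi)) (h.mem i hpos hi)

/-- The last value is the smallest, so every iterate is strictly above the minimum; the subgradient
inequality at `xs` is then strict, and `x i - x₀` is orthogonal to `g i`. In particular `g i ≠ 0`.
-/
theorem IsGFOMRun.inner_minimizer_neg {d n : ℕ} {f : Vec d → EReal} (hccp : IsCCP f)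
    {x₀ xs : Vec d} {x g : ℕ → Vec d} (h : IsGFOMRun f x₀ n x g) (hs : f xs < f (x n))
    {i : ℕ} (hi : i ≤ n) : inner ℝ (g i) (xs - x₀) < 0 := by
  have h1 : f xs < f (x i) := hs.trans_le (h.le_of_le hi)
  have h2 := (h.subgrad i hi xs).trans_lt h1
  rw [← hccp.coe_toReal_of_isSubgradient (h.subgrad i hi), ← EReal.coe_add, EReal.coe_lt_coe_iff]
    at h2
  have h3 : xs - x i = (xs - x₀) - (x i - x₀) := by abel
  rw [h3, inner_sub_right, h.inner_sub_eq_zero hi le_rfl] at h2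
  linarith

theorem IsGFOMRun.inner_eq_zero {d n : ℕ} {f : Vec d → EReal} {x₀ : Vec d} {x g : ℕ → Vec d}
    (h : IsGFOMRun f x₀ n x g) {i j : ℕ} (hi : i ≤ n) (hj : j ≤ n) (hij : i ≠ j) :
    inner ℝ (g i) (g j) = 0 := by
  rcases lt_or_gt_of_ne hij with hlt | hlt
  · rw [real_inner_comm]
    exact h.orth j (by omega) hj i hlt
  · exact h.orth i (by omega) hi j hlt

/-- No nonzero vector lies in the kernels of all Gram matrices of the truncated families. -/
theorem IsGFOMRun.eq_zero_of_forall_sum_smul_cols_eq_zero {d N n : ℕ} {f : Vec d → EReal}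
    (hccp : IsCCP f) {x₀ xs : Vec d} {x g : ℕ → Vec d} (h : IsGFOMRun f x₀ n x g)
    (hs : f xs < f (x n)) (hn : N + 1 ≤ n) {w : GramIdx N → ℝ}
    (hw : ∀ m ≤ N, ∑ c, w c • cols (truncPoints N m x xs) (truncGrads N m g) c = 0) : w = 0 := by
  have hx0 : ∀ m, truncPoints N m x xs (some 0) = x₀ := fun m => by simp [truncPoints, h.start]
  simp only [Fintype.sum_sum_type, cols, hx0, Finset.univ_unique, Finset.sum_singleton] at hw
  have hneg : ∀ i ≤ N + 1, inner ℝ (g i) (xs - x₀) < 0 := fun i hi =>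
    h.inner_minimizer_neg hccp hs (hi.trans hn)
  -- Pairing with `g (m + 1)` kills all subgradients and all genuine iterates of the `m`-th
  -- truncation, so only the copies of `xs` survive. The case `m = N` involves `g (N + 1)`, hence
  -- the need for `N + 1` iterations.
  have key : ∀ m ≤ N, (∑ j : Fin N, if m ≤ (j : ℕ) then w (.inr (.inl j)) else 0)
      + w (.inr (.inr ())) = 0 := fun m hm => by
    have h1 := congrArg (inner ℝ (g (m + 1))) (hw m hm)
    rw [inner_add_right, inner_add_right, inner_zero_right, inner_sum, inner_sum,
      Finset.sum_eq_zero fun j _ => ?_, zero_add, real_inner_smul_right] at h1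
    · have h2 : ∀ j : Fin N, inner ℝ (g (m + 1))
          (w (.inr (.inl j)) • (truncPoints N m x xs (some j.succ) - x₀))
          = (if m ≤ (j : ℕ) then w (.inr (.inl j)) else 0) * inner ℝ (g (m + 1)) (xs - x₀) :=
        fun j => by
          rw [real_inner_smul_right]
          by_cases hj : m ≤ (j : ℕ)
          · have : ¬ (j : ℕ) + 1 ≤ m := by omega
            simp [truncPoints, hj, this]
          · have h3 : (j : ℕ) + 1 ≤ m := by omega
            simp [truncPoints, hj, h3,
              h.inner_sub_eq_zero (i := m + 1) (j := (j : ℕ) + 1) (by omega) (by omega)]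
      rw [Finset.sum_congr rfl fun j _ => h2 j, ← Finset.sum_mul,
        show truncPoints N m x xs none = xs from rfl, ← add_mul] at h1
      exact (mul_eq_zero.1 h1).resolve_right (hneg _ (by omega)).ne
    · rw [real_inner_smul_right]
      by_cases hj : (j : ℕ) ≤ m
      · simp [truncGrads, hj, h.inner_eq_zero (i := m + 1) (j := j) (by omega) (by omega) (by omega)]
      · simp [truncGrads, hj]
  have hr : w (.inr (.inr ())) = 0 := by
    have := key N le_rfl
    rwa [Finset.sum_eq_zero fun j _ => if_neg (not_le.2 j.2), zero_add] at this
  -- Subtracting the relations for consecutive `m` isolates one coefficient.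
  have hq : ∀ j : Fin N, w (.inr (.inl j)) = 0 := fun j => by
    have h1 := key j (by omega)
    have h2 := key (j + 1) (by omega)
    have h3 : (∑ i : Fin N, if (j : ℕ) ≤ (i : ℕ) then w (.inr (.inl i)) else 0)
        = (∑ i : Fin N, if (j : ℕ) + 1 ≤ (i : ℕ) then w (.inr (.inl i)) else 0)
          + ∑ i : Fin N, if j = i then w (.inr (.inl i)) else 0 := by
      rw [← Finset.sum_add_distrib]
      refine Finset.sum_congr rfl fun i _ => ?_
      rcases lt_trichotomy (j : ℕ) i with hlt | heq | hgt
      · have : j ≠ i := fun e => by simp [e] at hlt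
        simp [hlt.le, Nat.succ_le_of_lt hlt, this]
      · have : j = i := Fin.ext heq
        simp [this]
      · have : j ≠ i := fun e => by simp [e] at hgt
        simp [hgt.not_ge, this, show ¬ (j : ℕ) + 1 ≤ i by omega]
    rw [Finset.sum_ite_eq, if_pos (Finset.mem_univ _)] at h3
    linarith
  have hp : ∀ i : Fin (N + 1), w (.inl i) = 0 := fun i => by
    have h1 := hw N le_rfl
    simp only [hq, hr, zero_smul, Finset.sum_const_zero, add_zero] at h1
    have h2 := congrArg (inner ℝ (g i)) h1
    have hi : ∀ k : Fin (N + 1), truncGrads N N g (some k) = g k := fun k => by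
      simp [truncGrads, Nat.le_of_lt_succ k.2]
    rw [inner_sum, inner_zero_right, Finset.sum_eq_single i (fun k _ hk => by
      rw [hi, real_inner_smul_right, h.inner_eq_zero (by omega) (by omega)
        (fun e => hk (Fin.ext e.symm)), mul_zero]) (by simp), hi, real_inner_smul_right] at h2
    refine (mul_eq_zero.1 h2).resolve_right fun h0 => ?_
    have := hneg i (by omega)
    rw [inner_self_eq_zero.1 h0, inner_zero_left] at this
    exact lt_irrefl _ this
  funext c
  rcases c with i | j | _
  · exact hp i
  · exact hq j
  · exact hr

/-- A Slater point, obtained by averaging the truncations of one execution. -/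
theorem IsGFOMRun.exists_posDef_primalFeasible {d N n : ℕ} {R : ℝ} (hR : 0 ≤ R)
    {𝓕 : Set (Vec d → EReal)} {K : Type*}
    {A : K → Matrix (GramIdx N) (GramIdx N) ℝ} {a : K → StarIdx N → ℝ} {b : K → ℝ}
    (hic : EncodesInterpolation 𝓕 A a b)
    {f : Vec d → EReal} {x₀ xs : Vec d} {x g : ℕ → Vec d}
    (hf : f ∈ 𝓕) (hccp : IsCCP f) (hs : ∀ y, f xs ≤ f y) (hxs : ‖x₀ - xs‖ ≤ R)
    (h : IsGFOMRun f x₀ n x g) (hn : N + 1 ≤ n) (hlt : f xs < f (x n)) :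
    ∃ G F, G.PosDef ∧ PrimalFeasible R A a b G F := by
  let y : ℕ → Matrix (GramIdx N) (GramIdx N) ℝ × (StarIdx N → ℝ) := fun m =>
    (gramMatrix (truncPoints N m x xs) (truncGrads N m g),
      fun i => (f (truncPoints N m x xs i)).toReal)
  have hN : (0 : ℝ) < (N + 1 : ℝ)⁻¹ := by positivity
  have hmem := (convex_primalFeasible R A a b).sum_mem (t := Finset.range (N + 1))
    (w := fun _ => (N + 1 : ℝ)⁻¹) (z := y) (fun _ _ => hN.le)
    (by simp; field_simp)
    (fun m hm => h.primalFeasible_trunc hR hic hf hccp hs hxs (by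
      have := Finset.mem_range.1 hm; omega))
  refine ⟨_, _, ?_, hmem⟩
  rw [Prod.fst_sum]
  have hsemi : ∀ m, (gramMatrix (truncPoints N m x xs) (truncGrads N m g)).PosSemidef :=
    fun m => posSemidef_gram ℝ _
  refine PosDef.of_dotProduct_mulVec_pos ?_ fun w hw => ?_
  · exact (posSemidef_sum _ fun m _ => (hsemi m).smul hN.le).1
  · simp only [sum_mulVec, dotProduct_sum, y, Prod.smul_fst, smul_mulVec, dotProduct_smul,
      star_trivial, smul_eq_mul]
    have hnn : ∀ m, 0 ≤ w ⬝ᵥ gramMatrix (truncPoints N m x xs) (truncGrads N m g) *ᵥ w :=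
      fun m => by simpa using (hsemi m).dotProduct_mulVec_nonneg w
    refine lt_of_le_of_ne (Finset.sum_nonneg fun m _ => mul_nonneg hN.le (hnn m)) fun h0 => hw ?_
    -- A vanishing average of nonnegative quadratic forms puts `w` in the kernel of each truncated
    -- Gram matrix.
    have h1 := (Finset.sum_eq_zero_iff_of_nonneg fun m _ => mul_nonneg hN.le (hnn m)).1 h0.symm
    refine h.eq_zero_of_forall_sum_smul_cols_eq_zero hccp hlt hn fun m hm => ?_
    have h2 := (mul_eq_zero.1 (h1 m (Finset.mem_range.2 (by omega)))).resolve_left hN.ne'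
    rw [gramMatrix, ← inner_sum_smul_sum_smul] at h2
    exact inner_self_eq_zero.1 h2

end PEP

/-! ### The upper bound and its tightness. -/

theorem PEP.inaccuracy_le_dualValue {d N : ℕ} {R : ℝ} (hR : 0 ≤ R)
    {𝓕 : Set (PEP.Vec d → EReal)} (h𝓕 : ∀ f ∈ 𝓕, PEP.IsCCP f) {K : Type*} [Fintype K]
    {A : K → Matrix (PEP.GramIdx N) (PEP.GramIdx N) ℝ} {a : K → PEP.StarIdx N → ℝ} {b : K → ℝ}
    (hic : PEP.EncodesInterpolation 𝓕 A a b) {f : PEP.Vec d → EReal} {x₀ y : PEP.Vec d}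
    (hf : PEP.IsInput 𝓕 R f x₀) (hy : PEP.IsGFOMOutput f x₀ N y) :
    PEP.inaccuracy f y ≤ PEP.dualValue R A a b := by
  obtain ⟨hf, xs, hs, hxs⟩ := hf
  obtain ⟨x, g, h, rfl⟩ := hy
  have hccp := h𝓕 f hf
  refine le_sInf ?_
  rintro _ ⟨α, β, γ, τ, hD, rfl⟩
  rw [PEP.inaccuracy_eq hs
    (hccp.coe_toReal_of_isSubgradient (h.subgrad N le_rfl)).symm
    (hccp.coe_toReal_of_isSubgradient (PEP.isSubgradient_zero_iff.2 hs)).symm,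
    EReal.coe_le_coe_iff]
  simpa [PEP.truncPoints] using PEP.weak_duality hD
    (h.primalFeasible_trunc hR hic hf hccp hs hxs le_rfl) (hD.psd.trace_mul_gram_nonneg _)

theorem mainTheorem2 (d N : ℕ) (R : ℝ) (hR : 0 ≤ R)
    (𝓕 : Set (PEP.Vec d → EReal)) (h𝓕 : ∀ f ∈ 𝓕, PEP.IsCCP f)
    {K : Type*} [Fintype K]
    (A : K → Matrix (PEP.GramIdx N) (PEP.GramIdx N) ℝ) (a : K → PEP.StarIdx N → ℝ) (b : K → ℝ)
    (hic : PEP.EncodesInterpolation 𝓕 A a b) :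
    (∀ (f : PEP.Vec d → EReal) (x₀ y : PEP.Vec d),
      PEP.IsInput 𝓕 R f x₀ → PEP.IsGFOMOutput f x₀ N y →
        PEP.inaccuracy f y ≤ PEP.dualValue R A a b) ∧
    (PEP.ContractionPreserving 𝓕 → 2 * N + 2 ≤ d →
      (∃ (f : PEP.Vec d → EReal) (x₀ y : PEP.Vec d),
        PEP.IsInput 𝓕 R f x₀ ∧ PEP.IsGFOMOutput f x₀ (2 * N + 1) y ∧ ∃ z, f z < f y) →
      IsLUB {w : EReal | ∃ (f : PEP.Vec d → EReal) (x₀ y : PEP.Vec d),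
        PEP.IsInput 𝓕 R f x₀ ∧ PEP.IsGFOMOutput f x₀ N y ∧ w = PEP.inaccuracy f y}
        (PEP.dualValue R A a b)) := by
  refine ⟨fun f x₀ y hf hy => PEP.inaccuracy_le_dualValue hR h𝓕 hic hf hy,
    fun hc hd hex => ⟨?_, fun w hw => ?_⟩⟩
  · rintro _ ⟨f, x₀, y, hf, hy, rfl⟩
    exact PEP.inaccuracy_le_dualValue hR h𝓕 hic hf hy
  obtain ⟨f, x₀, _, ⟨hf, xs, hs, hxs⟩, ⟨x, g, h, rfl⟩, z, hz⟩ := hex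
  -- The arithmetic side goal is `N + 1 ≤ 2 * N + 1`.
  have hS := h.exists_posDef_primalFeasible (N := N) hR hic hf (h𝓕 f hf) hs hxs (by omega)
    ((hs z).trans_lt hz)
  have hle : ∀ G F, G.PosDef → PEP.PrimalFeasible R A a b G F →
      ((F (some (Fin.last N)) - F none : ℝ) : EReal) ≤ w := fun G F hG hF => by
    obtain ⟨f', x₀', y', h1, h2, h3⟩ :=
      PEP.exists_run_of_primalFeasible hR hd hc hic hG.posSemidef hF
    exact hw ⟨f', x₀', y', h1, h2, h3.symm⟩
  -- An upper bound `⊥` is excluded by the real value at the Slater point; a real one is passed to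
  -- strong duality.
  induction w with
  | top => exact le_top
  | bot =>
    obtain ⟨G, F, hG, hF⟩ := hS
    exact absurd (le_bot_iff.1 (hle G F hG hF)) (EReal.coe_ne_bot _)
  | coe p =>
    obtain ⟨α, β, γ, τ, hD, hp⟩ := PEP.strong_duality hS fun G F hG hF =>
      EReal.coe_le_coe_iff.1 (hle G F hG hF)
    have h1 : PEP.dualValue R A a b ≤ ((τ * R ^ 2 - ∑ k, α k * b k : ℝ) : EReal) :=
      sInf_le ⟨α, β, γ, τ, hD, rfl⟩
    exact h1.trans (EReal.coe_le_coe_iff.2 hp)
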